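/- Let $X$ be a locally compact, Hausdorff, second countable, totally disconnected space (for example the Cantor set). An étale equivalence relation on $X$ is an equivalence relation $R$ on $X$ with a locally compact, Hausdorff, second countable topology which makes it a topological groupoid with unit space $X$ (where $(x,y)(y,z)=(x,z)$, $(x,y)^{-1}=(y,x)$ and $x\in X$ is identified with $(x,x)$) and for which $R\to X$, $(x,y)\mapsto x$, is a local homeomorphism. It is compact (a CEER) if $\{(x,y)\in R : x\neq y\}$ is compact. It is an AF-relation if $R=\bigcup_n R_n$ for a sequence of CEERs $R_1\subseteq R_2\subseteq\cdots$ on $X$ such that each $R_n$, with its own topology, is an open subspace of $R_{n+1}$, and $R$ carries the inductive limit topology. A twist over a locally compact Hausdorff étale groupoid $G$ with unit space $G^{0}$ is a locally compact Hausdorff topological groupoid $\Sigma$ with unit space $G^{0}$ together with a central extension $\mathbb{T}\times G^{0}\to\Sigma\to G$ of topological groupoids over the identity of $G^{0}$, where $\mathbb T$ is the circle group, $\mathbb{T}\times G^{0}\to\Sigma$ is injective with image the preimage of $G^{0}$ in $\Sigma$ (so that $\mathbb{T}$ acts freely on $\Sigma$), and $\Sigma\to G$ induces a homeomorphism $\Sigma/\mathbb{T}\cong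 G$. The twist is trivial if it is isomorphic to $G\times\mathbb{T}$ as a twist, i.e. if there is an isomorphism of topological groupoids $\Sigma\cong G\times\mathbb{T}$ compatible with the maps from $\mathbb{T}\times G^{0}$ and with the maps to $G$. **Proposition.** If $G$ is an AF-relation on $X$, then every twist $\Sigma$ over $G$ is trivial. -/

import Mathlib

open Topology

/-- A topological groupoid with unit space `X` and space of arrows `G`. An arrow `g` goes from
`src g` to `tgt g`, and the product `g h` is defined when `src g = tgt h`. -/
structure TopologicalGroupoid (X G : Type*) [TopologicalSpace X] [TopologicalSpace G] where
  src : G → X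
  tgt : G → X
  unit : X → G
  inv : G → G
  mul : ∀ g h : G, src g = tgt h → G
  src_unit : ∀ x, src (unit x) = x
  tgt_unit : ∀ x, tgt (unit x) = x
  src_inv : ∀ g, src (inv g) = tgt g
  tgt_inv : ∀ g, tgt (inv g) = src g
  src_mul : ∀ g h (e : src g = tgt h), src (mul g h e) = src h
  tgt_mul : ∀ g h (e : src g = tgt h), tgt (mul g h e) = tgt g
  mul_assoc : ∀ g h k (e : src g = tgt h) (e' : src h = tgt k),
    mul (mul g h e) k ((src_mul g h e).trans e') = mul g (mul h k e') (e.trans (tgt_mul h k e').symm)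
  unit_mul : ∀ g, mul (unit (tgt g)) g (src_unit _) = g
  mul_unit : ∀ g, mul g (unit (src g)) (tgt_unit _).symm = g
  inv_mul : ∀ g, mul (inv g) g (src_inv g) = unit (src g)
  mul_inv : ∀ g, mul g (inv g) (tgt_inv g).symm = unit (tgt g)
  continuous_src : Continuous src
  continuous_tgt : Continuous tgt
  continuous_unit : Continuous unit
  continuous_inv : Continuous inv
  continuous_mul : Continuous fun p : {p : G × G // src p.1 = tgt p.2} => mul p.1.1 p.1.2 p.2

/-! ### Étale and AF equivalence relations -/

/-- The pairs `(tgt, src)` of equivalent points, i.e. the equivalence relation `r` as a set. It is a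
type of its own so that it does not inherit the topology of `X × X`. -/
@[ext]
structure RelPair {X : Type*} (r : Setoid X) where
  tgt : X
  src : X
  rel : r tgt src

namespace RelPair

variable {X : Type*} {r s : Setoid X}

/-- The diagonal pair `(x, x)`. -/
def diag (r : Setoid X) (x : X) : RelPair r := ⟨x, x, r.refl x⟩

/-- The inverse `(x, y)⁻¹ = (y, x)`. -/
def inv (p : RelPair r) : RelPair r := ⟨p.src, p.tgt, r.symm p.rel⟩

/-- The product `(x, y) (y, z) = (x, z)`. -/
def mul (p q : RelPair r) (e : p.src = q.tgt) : RelPair r :=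
  ⟨p.tgt, q.src, r.trans p.rel (e ▸ q.rel)⟩

/-- The inclusion of a subrelation. -/
def inclusion (h : r ≤ s) (p : RelPair r) : RelPair s := ⟨p.tgt, p.src, h p.rel⟩

end RelPair

/-- An étale equivalence relation on `X`: an equivalence relation with a locally compact, Hausdorff,
second countable topology (in general not the one of `X × X`) that makes it a topological groupoid
with unit space `X` whose range map is a local homeomorphism. -/
structure EtaleEquivRel (X : Type*) [TopologicalSpace X] where
  rel : Setoid X
  topology : TopologicalSpace (RelPair rel)
  t2Space : T2Space (RelPair rel)
  locallyCompactSpace : LocallyCompactSpace (RelPair rel)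
  secondCountableTopology : SecondCountableTopology (RelPair rel)
  continuous_diag : Continuous (RelPair.diag rel)
  continuous_inv : Continuous (RelPair.inv : RelPair rel → RelPair rel)
  continuous_mul : Continuous fun p : {p : RelPair rel × RelPair rel // p.1.src = p.2.tgt} =>
    RelPair.mul p.1.1 p.1.2 p.2
  isLocalHomeomorph_tgt : IsLocalHomeomorph (RelPair.tgt : RelPair rel → X)

attribute [instance] EtaleEquivRel.topology EtaleEquivRel.t2Space EtaleEquivRel.locallyCompactSpace
  EtaleEquivRel.secondCountableTopology

namespace EtaleEquivRel

variable {X : Type*} [TopologicalSpace X]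

/-- An étale equivalence relation as a topological groupoid. -/
def groupoid (R : EtaleEquivRel X) : TopologicalGroupoid X (RelPair R.rel) where
  src := RelPair.src
  tgt := RelPair.tgt
  unit := RelPair.diag R.rel
  inv := RelPair.inv
  mul := RelPair.mul
  src_unit _ := rfl
  tgt_unit _ := rfl
  src_inv _ := rfl
  tgt_inv _ := rfl
  src_mul _ _ _ := rfl
  tgt_mul _ _ _ := rfl
  mul_assoc _ _ _ _ _ := rfl
  unit_mul _ := rfl
  mul_unit _ := rfl
  inv_mul _ := rfl
  mul_inv _ := rfl
  continuous_src := R.isLocalHomeomorph_tgt.continuous.comp R.continuous_inv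
  continuous_tgt := R.isLocalHomeomorph_tgt.continuous
  continuous_unit := R.continuous_diag
  continuous_inv := R.continuous_inv
  continuous_mul := R.continuous_mul

/-- `R` is a compact étale equivalence relation (CEER): its off-diagonal part is compact. (If `X` is
compact, this says that `R` is compact.) -/
def IsCEER (R : EtaleEquivRel X) : Prop :=
  IsCompact {p : RelPair R.rel | p.tgt ≠ p.src}

/-- `R` is an AF-relation: the inductive limit, as a set and as a topological space, of a sequence of
compact étale equivalence relations `K n`, where each `K n`, with its topology, is an open
subrelation of `K (n + 1)`. -/
def IsAF (R : EtaleEquivRel X) : Prop :=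
  ∃ (K : ℕ → EtaleEquivRel X) (mono : ∀ n, (K n).rel ≤ (K (n + 1)).rel)
    (le : ∀ n, (K n).rel ≤ R.rel),
    (∀ n, (K n).IsCEER) ∧
    (∀ n, IsOpenEmbedding (RelPair.inclusion (mono n))) ∧
    (∀ x y, R.rel x y → ∃ n, (K n).rel x y) ∧
    ∀ U : Set (RelPair R.rel), IsOpen U ↔ ∀ n, IsOpen (RelPair.inclusion (le n) ⁻¹' U)

end EtaleEquivRel

/-! ### Twists -/

/-- A twist over the topological groupoid `𝒢`: a locally compact Hausdorff topological groupoid with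
space of arrows `S` and with the same unit space `X`, together with a central extension
`Circle × X → S → 𝒢` of topological groupoids, where `S / Circle ≅ 𝒢`. -/
structure Twist {X G : Type*} [TopologicalSpace X] [TopologicalSpace G]
    (𝒢 : TopologicalGroupoid X G) (S : Type*) [TopologicalSpace S] where
  groupoid : TopologicalGroupoid X S
  t2Space : T2Space S
  locallyCompactSpace : LocallyCompactSpace S
  /-- The inclusion of the trivial bundle of groups `Circle × X`. -/
  incl : Circle × X → S
  /-- The projection onto `𝒢`. -/
  proj : S → G
  src_incl : ∀ z x, groupoid.src (incl (z, x)) = x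
  tgt_incl : ∀ z x, groupoid.tgt (incl (z, x)) = x
  incl_mul : ∀ z w x, incl (z * w, x) =
    groupoid.mul (incl (z, x)) (incl (w, x)) ((src_incl z x).trans (tgt_incl w x).symm)
  continuous_incl : Continuous incl
  injective_incl : Function.Injective incl
  src_proj : ∀ s, 𝒢.src (proj s) = groupoid.src s
  tgt_proj : ∀ s, 𝒢.tgt (proj s) = groupoid.tgt s
  proj_mul : ∀ s t (e : groupoid.src s = groupoid.tgt t), proj (groupoid.mul s t e) =
    𝒢.mul (proj s) (proj t) ((src_proj s).trans (e.trans (tgt_proj t).symm))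
  /-- The projection is a quotient map. As its fibres are the orbits of `Circle`, it identifies
  `S / Circle` with `𝒢`. -/
  isQuotientMap_proj : IsQuotientMap proj
  /-- Exactness: the kernel of the projection is the image of the inclusion. -/
  exact : ∀ s, (∃ x, proj s = 𝒢.unit x) ↔ s ∈ Set.range incl
  /-- The extension is central. -/
  central : ∀ z s, groupoid.mul (incl (z, groupoid.tgt s)) s (src_incl _ _) =
    groupoid.mul s (incl (z, groupoid.src s)) (tgt_incl _ _).symm

namespace Twist

variable {X G : Type*} [TopologicalSpace X] [TopologicalSpace G]

/-- The groupoid `𝒢 × Circle`. -/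
noncomputable def prodCircle (𝒢 : TopologicalGroupoid X G) : TopologicalGroupoid X (G × Circle) where
  src p := 𝒢.src p.1
  tgt p := 𝒢.tgt p.1
  unit x := (𝒢.unit x, 1)
  inv p := (𝒢.inv p.1, p.2⁻¹)
  mul p q e := (𝒢.mul p.1 q.1 e, p.2 * q.2)
  src_unit _ := 𝒢.src_unit _
  tgt_unit _ := 𝒢.tgt_unit _
  src_inv _ := 𝒢.src_inv _
  tgt_inv _ := 𝒢.tgt_inv _
  src_mul _ _ _ := 𝒢.src_mul _ _ _
  tgt_mul _ _ _ := 𝒢.tgt_mul _ _ _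
  mul_assoc _ _ _ _ _ := Prod.ext (𝒢.mul_assoc _ _ _ _ _) (mul_assoc _ _ _)
  unit_mul _ := Prod.ext (𝒢.unit_mul _) (one_mul _)
  mul_unit _ := Prod.ext (𝒢.mul_unit _) (mul_one _)
  inv_mul _ := Prod.ext (𝒢.inv_mul _) (inv_mul_cancel _)
  mul_inv _ := Prod.ext (𝒢.mul_inv _) (mul_inv_cancel _)
  continuous_src := 𝒢.continuous_src.comp continuous_fst
  continuous_tgt := 𝒢.continuous_tgt.comp continuous_fst
  continuous_unit := 𝒢.continuous_unit.prodMk continuous_const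
  continuous_inv := (𝒢.continuous_inv.comp continuous_fst).prodMk continuous_snd.inv
  continuous_mul := by
    refine Continuous.prodMk ?_ (by fun_prop)
    exact 𝒢.continuous_mul.comp (Continuous.subtype_mk (f := fun p :
      {p : (G × Circle) × (G × Circle) // 𝒢.src p.1.1 = 𝒢.tgt p.2.1} => (p.1.1.1, p.1.2.1))
      (by fun_prop) fun p => p.2)

/-- The trivial twist `𝒢 × Circle` over `𝒢`. -/
noncomputable def trivial (𝒢 : TopologicalGroupoid X G) [T2Space G] [LocallyCompactSpace G] :
    Twist 𝒢 (G × Circle) where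
  groupoid := prodCircle 𝒢
  t2Space := inferInstance
  locallyCompactSpace := inferInstance
  incl p := (𝒢.unit p.2, p.1)
  proj p := p.1
  src_incl _ _ := 𝒢.src_unit _
  tgt_incl _ _ := 𝒢.tgt_unit _
  incl_mul _ _ x := Prod.ext (by
    have h := 𝒢.unit_mul (𝒢.unit x)
    simp only [𝒢.tgt_unit] at h
    exact h.symm) rfl
  continuous_incl := (𝒢.continuous_unit.comp continuous_snd).prodMk continuous_fst
  injective_incl := fun p q h => by
    have h1 := congrArg (fun u => 𝒢.src u.1) h
    simp only [𝒢.src_unit] at h1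
    exact Prod.ext (congrArg Prod.snd h) h1
  src_proj _ := rfl
  tgt_proj _ := rfl
  proj_mul _ _ _ := rfl
  isQuotientMap_proj := isOpenMap_fst.isQuotientMap continuous_fst Prod.fst_surjective
  exact s := ⟨fun ⟨x, hx⟩ => ⟨(s.2, x), Prod.ext hx.symm rfl⟩, fun ⟨p, hp⟩ => ⟨p.2, by rw [← hp]⟩⟩
  central z s := Prod.ext ((𝒢.unit_mul s.1).trans (𝒢.mul_unit s.1).symm) (mul_comm z s.2)

/-- An isomorphism of twists over `𝒢`: a homeomorphic isomorphism of groupoids that is compatible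
with the inclusions of `Circle × X` and with the projections onto `𝒢`. -/
structure Iso {𝒢 : TopologicalGroupoid X G} {S S' : Type*} [TopologicalSpace S]
    [TopologicalSpace S'] (E : Twist 𝒢 S) (E' : Twist 𝒢 S') where
  toHomeomorph : S ≃ₜ S'
  src_map : ∀ s, E'.groupoid.src (toHomeomorph s) = E.groupoid.src s
  tgt_map : ∀ s, E'.groupoid.tgt (toHomeomorph s) = E.groupoid.tgt s
  map_mul : ∀ s t (e : E.groupoid.src s = E.groupoid.tgt t),
    toHomeomorph (E.groupoid.mul s t e) = E'.groupoid.mul (toHomeomorph s) (toHomeomorph t)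
      ((src_map s).trans (e.trans (tgt_map t).symm))
  map_incl : ∀ p, toHomeomorph (E.incl p) = E'.incl p
  proj_map : ∀ s, E'.proj (toHomeomorph s) = E.proj s

/-- A twist is trivial if it is isomorphic to `𝒢 × Circle`. -/
def IsTrivial {𝒢 : TopologicalGroupoid X G} [T2Space G] [LocallyCompactSpace G] {S : Type*}
    [TopologicalSpace S] (E : Twist 𝒢 S) : Prop :=
  Nonempty (Iso E (trivial 𝒢))

end Twist

/-!
A twist is a principal circle bundle over the groupoid. It has local sections: extend the orbit map
`z • s₀ ↦ z` to a complex function on the twist by Tietze's theorem, average it over the circle to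
make it equivariant, and divide out its phase near `s₀`. Over a totally disconnected base such
sections patch along clopen sets.

In a CEER one can continuously choose a base point `f x` in the class of every `x`. Let `Kₙ` be the
CEERs with union `R`, with base points `fₙ x`, and lift `x ↦ (x, fₙ x)` to a continuous map `dₙ`
into the twist. Put `c₀ = d₀` and `cₙ₊₁ x = cₙ x · dₙ₊₁ (fₙ x)`. On `Kₙ` the factor
`dₙ₊₁ (fₙ x) = dₙ₊₁ (fₙ y)` cancels from the quotient `cₙ₊₁ x · (cₙ₊₁ y)⁻¹`, so the multiplicative
sections `(x, y) ↦ cₙ x · (cₙ y)⁻¹` over `Kₙ` extend each other and glue to a splitting over `R`.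
-/

/-! ### Equivariant functions and local sections of circle bundles -/

section IsotypicAverage

open MeasureTheory

variable {K S : Type*} [Group K] [MeasurableSpace K] [MulAction K S]

/-- The average of `h` over the action of `K`, weighted by `χ`: the projection of `h` onto the
functions that transform under `K` by the character `χ`. -/
noncomputable def isotypicAverage (μ : Measure K) (χ : K →* ℂ) (h : S → ℂ) (s : S) : ℂ :=
  ∫ k, χ k * h (k⁻¹ • s) ∂μ

theorem isotypicAverage_smul [MeasurableMul K] (μ : Measure K) [μ.IsMulLeftInvariant]
    (χ : K →* ℂ) (h : S → ℂ) (k : K) (s : S) :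
    isotypicAverage μ χ h (k • s) = χ k * isotypicAverage μ χ h s := calc
  _ = ∫ l, χ (k * l) * h ((k * l)⁻¹ • k • s) ∂μ :=
    (integral_mul_left_eq_self (fun l => χ l * h (l⁻¹ • k • s)) k).symm
  _ = ∫ l, χ k * (χ l * h (l⁻¹ • s)) ∂μ := by
    simp only [map_mul, mul_inv_rev, mul_smul, inv_smul_smul, mul_assoc]
  _ = χ k * isotypicAverage μ χ h s := integral_const_mul _ _

theorem continuous_isotypicAverage [TopologicalSpace K] [ContinuousInv K] [CompactSpace K]
    [OpensMeasurableSpace K] [TopologicalSpace S] [ContinuousSMul K S] (μ : Measure K)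
    [IsFiniteMeasureOnCompacts μ] {χ : K →* ℂ} (hχ : Continuous χ) {h : S → ℂ}
    (hh : Continuous h) : Continuous (isotypicAverage μ χ h) := by
  rw [← continuousOn_univ]
  refine continuousOn_integral_of_compact_support isCompact_univ ?_ (by simp)
  exact Continuous.continuousOn (by fun_prop)

end IsotypicAverage

theorem exists_continuous_extension_of_injective {C S : Type*} [TopologicalSpace C]
    [CompactSpace C] [TopologicalSpace S] [T2Space S] [LocallyCompactSpace S] {e : C → S}
    (he : Continuous e) (hinj : Function.Injective e) (f : C(C, ℂ)) :
    ∃ h : C(S, ℂ), ∀ x, h (e x) = f x := by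
  have hemb : IsClosedEmbedding fun x => (e x : OnePoint S) :=
    (OnePoint.continuous_coe.comp he).isClosedEmbedding (OnePoint.coe_injective.comp hinj)
  obtain ⟨h, hh⟩ := ContinuousMap.exists_extension' hemb f
  exact ⟨h.comp ⟨_, OnePoint.continuous_coe⟩, congrFun hh⟩

open MeasureTheory in
theorem exists_continuous_equivariant_ne_zero {K S : Type*} [Group K] [TopologicalSpace K]
    [IsTopologicalGroup K] [CompactSpace K] [TopologicalSpace S] [T2Space S]
    [LocallyCompactSpace S] [MulAction K S] [ContinuousSMul K S] {χ : K →* ℂ}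
    (hχ : Continuous χ) {s₀ : S} (hs₀ : Function.Injective fun k : K => k • s₀) :
    ∃ Φ : S → ℂ, Continuous Φ ∧ Φ s₀ ≠ 0 ∧ ∀ k s, Φ (k • s) = χ k * Φ s := by
  borelize K
  let μ : Measure K := Measure.haar
  obtain ⟨h, hh⟩ := exists_continuous_extension_of_injective (by fun_prop) hs₀ ⟨χ, hχ⟩
  refine ⟨isotypicAverage μ χ h, continuous_isotypicAverage μ hχ h.continuous, ?_,
    isotypicAverage_smul μ χ h⟩
  have integrand_eq_one (k : K) : χ k * h (k⁻¹ • s₀) = 1 := by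
    rw [hh k⁻¹, ContinuousMap.coe_mk, ← map_mul, mul_inv_cancel, map_one]
  have hμ : μ.real Set.univ ≠ 0 :=
    ENNReal.toReal_ne_zero.2 ⟨isOpen_univ.measure_ne_zero μ Set.univ_nonempty, measure_ne_top μ _⟩
  simpa [isotypicAverage, integrand_eq_one] using hμ

/-- The direction `w / |w|` of a nonzero complex number, with the junk value `1` at `0`. -/
noncomputable def phase (w : ℂ) : Circle :=
  (w.arg : Real.Angle).toCircle

theorem phase_circle_mul (z : Circle) {w : ℂ} (hw : w ≠ 0) : phase (z * w) = z * phase w := by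
  rw [phase, Complex.arg_mul_coe_angle z.coe_ne_zero hw, Real.Angle.toCircle_add,
    Real.Angle.toCircle_coe, Circle.exp_arg, phase]

theorem continuousAt_phase {w : ℂ} (hw : w ≠ 0) : ContinuousAt phase w := by
  have : Continuous Real.Angle.toCircle := continuous_coinduced_dom.2 Circle.exp.continuous
  exact this.continuousAt.comp (Complex.continuousAt_arg_coe_angle hw)

/-- Every point `b` of the base has a neighbourhood over which `p` has a continuous section. The
section is encoded as a function on the whole base, with arbitrary values far from `b`. -/
def HasLocalSections {S G : Type*} [TopologicalSpace S] [TopologicalSpace G] (p : S → G) : Prop :=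
  ∀ b, ∃ τ : G → S, ∀ᶠ g in 𝓝 b, ContinuousAt τ g ∧ p (τ g) = g

theorem isOpenQuotientMap_of_fibers_eq_orbits {K S G : Type*} [Group K] [TopologicalSpace S]
    [TopologicalSpace G] [MulAction K S] [ContinuousConstSMul K S] {p : S → G}
    (hp : IsQuotientMap p) (hfib : ∀ s t, p s = p t ↔ s ∈ MulAction.orbit K t) :
    IsOpenQuotientMap p := by
  refine ⟨hp.surjective, hp.continuous, fun U hU => ?_⟩
  have : p ⁻¹' (p '' U) = ⋃ k : K, (k • ·) ⁻¹' U := by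
    ext s
    simp [hfib, MulAction.mem_orbit_iff]
  rw [← hp.isOpen_preimage, this]
  exact isOpen_iUnion fun k => hU.preimage (continuous_const_smul k)

theorem hasLocalSections_of_free_circle_action {S G : Type*} [TopologicalSpace S] [T2Space S]
    [LocallyCompactSpace S] [TopologicalSpace G] [MulAction Circle S] [ContinuousSMul Circle S]
    {p : S → G} (hp : IsQuotientMap p) (hfib : ∀ s t, p s = p t ↔ s ∈ MulAction.orbit Circle t)
    (hfree : ∀ s : S, Function.Injective fun z : Circle => z • s) : HasLocalSections p := by
  have hopen := isOpenQuotientMap_of_fibers_eq_orbits hp hfib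
  have hpsmul (z : Circle) (s : S) : p (z • s) = p s := (hfib _ _).2 ⟨z, rfl⟩
  intro b
  obtain ⟨s₀, rfl⟩ := hp.surjective b
  have hcoe : Continuous Circle.coeHom := continuous_subtype_val
  obtain ⟨Φ, hΦ, hΦs₀, hequiv⟩ := exists_continuous_equivariant_ne_zero hcoe (hfree s₀)
  let V : Set S := {s | Φ s ≠ 0}
  have hV : IsOpen V := isOpen_ne_fun hΦ continuous_const
  -- Each orbit in `V` meets `{Φ > 0}` in exactly one point, and `normalize` sends the orbit to it.
  let normalize (s : S) : S := (phase (Φ s))⁻¹ • s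
  have normalize_smul {s : S} (hs : s ∈ V) (z : Circle) : normalize (z • s) = normalize s := by
    have hphase : phase (Φ (z • s)) = z * phase (Φ s) := by
      rw [hequiv]
      exact phase_circle_mul z hs
    simp only [normalize, hphase, smul_smul, mul_inv_rev, inv_mul_cancel_right]
  have continuousAt_normalize {s : S} (hs : s ∈ V) : ContinuousAt normalize s :=
    ((continuousAt_phase hs).comp hΦ.continuousAt).inv.smul continuousAt_id
  let lift : G → S := Function.surjInv hp.surjective
  have hlift (g : G) : p (lift g) = g := Function.surjInv_eq _ g
  have normalize_lift {s : S} (hs : s ∈ V) : normalize (lift (p s)) = normalize s := by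
    obtain ⟨z, hz⟩ := (hfib _ _).1 (hlift (p s))
    rw [← hz]
    exact normalize_smul hs z
  refine ⟨normalize ∘ lift, ?_⟩
  filter_upwards [(hopen.isOpenMap V hV).mem_nhds ⟨s₀, hΦs₀, rfl⟩]
  rintro _ ⟨s, hs, rfl⟩
  refine ⟨hopen.continuousAt_comp_iff.1 ((continuousAt_normalize hs).congr ?_),
    (hpsmul _ _).trans (hlift _)⟩
  filter_upwards [hV.mem_nhds hs] with t ht using (normalize_lift ht).symm

/-! ### Clopen covers and lifting -/

theorem exists_countable_isClopen_cover {X : Type*} [TopologicalSpace X] [T2Space X]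
    [LocallyCompactSpace X] [LindelofSpace X] [TotallyDisconnectedSpace X] {U : X → Set X}
    (hU : ∀ x, U x ∈ 𝓝 x) :
    ∃ (s : Set X) (A : X → Set X), s.Countable ∧ (∀ x, IsClopen (A x)) ∧ (∀ x, A x ⊆ U x) ∧
      ∀ x, ∃ i : s, x ∈ A i := by
  choose A hA hxA hAU using fun x =>
    loc_compact_Haus_tot_disc_of_zero_dim.mem_nhds_iff.1 (hU x)
  obtain ⟨s, hs, hcov⟩ := countable_cover_nhds fun x => (hA x).isOpen.mem_nhds (hxA x)
  refine ⟨s, A, hs, hA, hAU, fun x => ?_⟩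
  obtain ⟨i, hi, hx⟩ := Set.mem_iUnion₂.1 (hcov ▸ Set.mem_univ x)
  exact ⟨⟨i, hi⟩, hx⟩

/-- The last clause makes `n` invariant under any equivalence relation for which all `A i` are
saturated. -/
theorem exists_isLocallyConstant_index {X ι : Type*} [TopologicalSpace X] [Countable ι]
    {A : ι → Set X} (hA : ∀ i, IsClopen (A i)) (hcov : ∀ x, ∃ i, x ∈ A i) :
    ∃ n : X → ι, IsLocallyConstant n ∧ (∀ x, x ∈ A (n x)) ∧
      ∀ x y, (∀ i, x ∈ A i ↔ y ∈ A i) → n x = n y := by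
  obtain ⟨e, he⟩ := exists_injective_nat ι
  let n (x : X) : ι := Function.argminOn e {i | x ∈ A i} (hcov x)
  have hmem (x : X) : x ∈ A (n x) := Function.argminOn_mem e {i | x ∈ A i} (hcov x)
  have hmin {x : X} {i : ι} (hi : x ∈ A i) : e (n x) ≤ e i :=
    Function.argminOn_le e {i | x ∈ A i} hi
  refine ⟨n, (IsLocallyConstant.iff_eventually_eq n).2 fun x => ?_, hmem, fun x y h => ?_⟩
  · have hfin : {i | e i < e (n x)}.Finite := (Set.finite_Iio (e (n x))).preimage he.injOn
    have hnotMem : ∀ᶠ y in 𝓝 x, ∀ i ∈ {i | e i < e (n x)}, y ∉ A i :=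
      (Filter.eventually_all_finite hfin).2 fun i hi =>
        (hA i).compl.isOpen.mem_nhds fun hx => (hmin hx).not_gt hi
    filter_upwards [hnotMem, (hA (n x)).isOpen.mem_nhds (hmem x)] with y hy hxy
    exact he ((hmin hxy).antisymm (not_lt.1 fun hlt => hy _ hlt (hmem y)))
  · exact he ((hmin ((h _).2 (hmem y))).antisymm (hmin ((h _).1 (hmem x))))

theorem HasLocalSections.exists_continuous_lift {S G Y : Type*} [TopologicalSpace S]
    [TopologicalSpace G] [TopologicalSpace Y] [T2Space Y] [LocallyCompactSpace Y]
    [LindelofSpace Y] [TotallyDisconnectedSpace Y] {p : S → G} (hp : HasLocalSections p)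
    {g : Y → G} (hg : Continuous g) : ∃ c : Y → S, Continuous c ∧ ∀ y, p (c y) = g y := by
  choose τ hτ using fun y => hp (g y)
  obtain ⟨s, A, hs, hA, hAτ, hcov⟩ :=
    exists_countable_isClopen_cover fun y => hg.continuousAt.eventually (hτ y)
  have := hs.to_subtype
  obtain ⟨n, hn, hmem, -⟩ := exists_isLocallyConstant_index (A := fun i : s => A i)
    (fun i => hA i) hcov
  have hτn (y : Y) := hAτ (n y) (hmem y)
  refine ⟨fun y => τ (n y) (g y), continuous_iff_continuousAt.2 fun y => ?_, fun y => (hτn y).2⟩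
  refine ((hτn y).1.comp hg.continuousAt).congr ?_
  filter_upwards [hn.eventually_eq y] with x hx
  rw [hx, Function.comp_apply]

theorem continuousAt_section_of_isOpenMap {Y X : Type*} [TopologicalSpace Y] [TopologicalSpace X]
    {p : Y → X} (hp : IsOpenMap p) {c : X → Y} {x : X} (hpc : p (c x) = x)
    (h : ∀ᶠ y in 𝓝 (c x), c (p y) = y) : ContinuousAt c x := by
  have hle : 𝓝 x ≤ Filter.map p (𝓝 (c x)) := by simpa only [hpc] using hp.nhds_le (c x)
  have htendsto : Filter.Tendsto (c ∘ p) (𝓝 (c x)) (𝓝 (c x)) :=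
    Filter.Tendsto.congr' (h.mono fun _ => Eq.symm) Filter.tendsto_id
  exact (Filter.tendsto_map'_iff.2 htendsto).mono_left hle

theorem continuous_of_isClosed_graph {X Y : Type*} [TopologicalSpace X] [TopologicalSpace Y]
    [CompactSpace Y] {f : X → Y} (hf : IsClosed {q : X × Y | f q.1 = q.2}) : Continuous f := by
  refine continuous_iff_isClosed.2 fun C hC => ?_
  have : f ⁻¹' C = Prod.fst '' ({q : X × Y | f q.1 = q.2} ∩ Prod.snd ⁻¹' C) := by
    ext x
    simp
  rw [this]
  exact isClosedMap_fst_of_compactSpace _ (hf.inter (hC.preimage continuous_snd))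

/-! ### Topological groupoids and contractions -/

namespace TopologicalGroupoid

variable {X G : Type*} [TopologicalSpace X] [TopologicalSpace G] (𝒢 : TopologicalGroupoid X G)

theorem mul_congr {g g' h h' : G} (hg : g = g') (hh : h = h') (e : 𝒢.src g = 𝒢.tgt h) :
    𝒢.mul g h e = 𝒢.mul g' h' (hg ▸ hh ▸ e) := by
  subst hg hh
  rfl

/-- The quotient `g h⁻¹` of two arrows with the same source. -/
def div (g h : G) (e : 𝒢.src g = 𝒢.src h) : G :=
  𝒢.mul g (𝒢.inv h) (e.trans (𝒢.tgt_inv h).symm)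

variable {𝒢} {g h k : G}

theorem unit_mul' {x : X} (e : 𝒢.src (𝒢.unit x) = 𝒢.tgt g) : 𝒢.mul (𝒢.unit x) g e = g := by
  obtain rfl : x = 𝒢.tgt g := (𝒢.src_unit x).symm.trans e
  exact 𝒢.unit_mul g

theorem mul_unit' {x : X} (e : 𝒢.src g = 𝒢.tgt (𝒢.unit x)) : 𝒢.mul g (𝒢.unit x) e = g := by
  obtain rfl : 𝒢.src g = x := e.trans (𝒢.tgt_unit x)
  exact 𝒢.mul_unit g

theorem tgt_div (e : 𝒢.src g = 𝒢.src h) : 𝒢.tgt (𝒢.div g h e) = 𝒢.tgt g :=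
  𝒢.tgt_mul _ _ _

theorem src_div (e : 𝒢.src g = 𝒢.src h) : 𝒢.src (𝒢.div g h e) = 𝒢.tgt h :=
  (𝒢.src_mul _ _ _).trans (𝒢.src_inv h)

theorem div_self (g : G) : 𝒢.div g g rfl = 𝒢.unit (𝒢.tgt g) :=
  𝒢.mul_inv g

theorem div_mul_cancel (e : 𝒢.src g = 𝒢.src h) : 𝒢.mul (𝒢.div g h e) h (src_div e) = g := by
  unfold div
  rw [𝒢.mul_assoc g (𝒢.inv h) h _ (𝒢.src_inv h), 𝒢.mul_congr rfl (𝒢.inv_mul h), mul_unit']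

theorem eq_div_of_mul_eq {a : G} (e : 𝒢.src a = 𝒢.tgt h) (H : 𝒢.mul a h e = g) :
    a = 𝒢.div g h (H ▸ 𝒢.src_mul a h e) := by
  subst H
  unfold div
  rw [𝒢.mul_assoc a h (𝒢.inv h) e (𝒢.tgt_inv h).symm, 𝒢.mul_congr rfl (𝒢.mul_inv h), mul_unit']

theorem mul_right_cancel {a b : G} {ea : 𝒢.src a = 𝒢.tgt h} {eb : 𝒢.src b = 𝒢.tgt h}
    (H : 𝒢.mul a h ea = 𝒢.mul b h eb) : a = b :=
  (eq_div_of_mul_eq ea H).trans (eq_div_of_mul_eq eb rfl).symm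

theorem div_mul_div (e : 𝒢.src g = 𝒢.src h) (e' : 𝒢.src h = 𝒢.src k) :
    𝒢.mul (𝒢.div g h e) (𝒢.div h k e') ((src_div e).trans (tgt_div e').symm) =
      𝒢.div g k (e.trans e') := by
  apply eq_div_of_mul_eq ((𝒢.src_mul _ _ _).trans (src_div e'))
  rw [𝒢.mul_assoc _ _ _ _ (src_div e'), 𝒢.mul_congr rfl (div_mul_cancel e'), div_mul_cancel]

theorem div_mul_mul_right {k' : G} (eg : 𝒢.src g = 𝒢.tgt k) (eh : 𝒢.src h = 𝒢.tgt k')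
    (hk : k = k') :
    𝒢.div (𝒢.mul g k eg) (𝒢.mul h k' eh)
        ((𝒢.src_mul _ _ _).trans ((congrArg 𝒢.src hk).trans (𝒢.src_mul _ _ _).symm)) =
      𝒢.div g h (eg.trans ((congrArg 𝒢.tgt hk).trans eh.symm)) := by
  subst hk
  refine (eq_div_of_mul_eq ((src_div _).trans (𝒢.tgt_mul _ _ _).symm) ?_).symm
  rw [← 𝒢.mul_assoc _ _ _ (src_div (eg.trans eh.symm)) eh, 𝒢.mul_congr (div_mul_cancel _) rfl]

theorem eq_unit_of_mul_self (e : 𝒢.src g = 𝒢.tgt g) (H : 𝒢.mul g g e = g) :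
    g = 𝒢.unit (𝒢.tgt g) :=
  (eq_div_of_mul_eq e H).trans (div_self g)

theorem continuous_mul' {Y : Type*} [TopologicalSpace Y] {a b : Y → G} (ha : Continuous a)
    (hb : Continuous b) (e : ∀ y, 𝒢.src (a y) = 𝒢.tgt (b y)) :
    Continuous fun y => 𝒢.mul (a y) (b y) (e y) :=
  𝒢.continuous_mul.comp ((ha.prodMk hb).subtype_mk e)

theorem continuous_div {Y : Type*} [TopologicalSpace Y] {a b : Y → G} (ha : Continuous a)
    (hb : Continuous b) (e : ∀ y, 𝒢.src (a y) = 𝒢.src (b y)) :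
    Continuous fun y => 𝒢.div (a y) (b y) (e y) :=
  continuous_mul' ha (𝒢.continuous_inv.comp hb) _

/-- A contraction of the classes of `r` inside `𝒢`: a continuous choice, for every point `x`, of an
arrow to `x` from a base point that depends only on the class of `x`. -/
structure Contraction (𝒢 : TopologicalGroupoid X G) (r : Setoid X) where
  arrow : X → G
  continuous_arrow : Continuous arrow
  tgt_arrow : ∀ x, 𝒢.tgt (arrow x) = x
  rel_src : ∀ x, r x (𝒢.src (arrow x))
  src_eq : ∀ {x y}, r x y → 𝒢.src (arrow x) = 𝒢.src (arrow y)

namespace Contraction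

variable {r s : Setoid X}

/-- The arrow from `p.src` to `p.tgt` through the base point of their common class. -/
def transport (c : Contraction 𝒢 r) (p : RelPair r) : G :=
  𝒢.div (c.arrow p.tgt) (c.arrow p.src) (c.src_eq p.rel)

theorem tgt_transport (c : Contraction 𝒢 r) (p : RelPair r) : 𝒢.tgt (c.transport p) = p.tgt :=
  (tgt_div _).trans (c.tgt_arrow _)

theorem src_transport (c : Contraction 𝒢 r) (p : RelPair r) : 𝒢.src (c.transport p) = p.src :=
  (src_div _).trans (c.tgt_arrow _)

theorem transport_mul (c : Contraction 𝒢 r) (p q : RelPair r) (e : p.src = q.tgt) :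
    c.transport (p.mul q e) = 𝒢.mul (c.transport p) (c.transport q)
      ((c.src_transport p).trans (e.trans (c.tgt_transport q).symm)) := by
  obtain ⟨x, y, hxy⟩ := p
  obtain ⟨y', z, hyz⟩ := q
  obtain rfl : y = y' := e
  exact (div_mul_div _ _).symm

/-- The base points of `c` are moved on to those of the coarser relation `s`. -/
def trans (c : Contraction 𝒢 r) (d : Contraction 𝒢 s) (h : r ≤ s) : Contraction 𝒢 s where
  arrow x := 𝒢.mul (c.arrow x) (d.arrow (𝒢.src (c.arrow x))) (d.tgt_arrow _).symm
  continuous_arrow := continuous_mul' c.continuous_arrow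
    (d.continuous_arrow.comp (𝒢.continuous_src.comp c.continuous_arrow)) _
  tgt_arrow x := (𝒢.tgt_mul _ _ _).trans (c.tgt_arrow x)
  rel_src x := by
    rw [𝒢.src_mul]
    exact s.trans (h (c.rel_src x)) (d.rel_src _)
  src_eq {x y} hxy := by
    have hbase : s (𝒢.src (c.arrow x)) (𝒢.src (c.arrow y)) :=
      s.trans (s.symm (h (c.rel_src x))) (s.trans hxy (h (c.rel_src y)))
    rw [𝒢.src_mul, 𝒢.src_mul, d.src_eq hbase]

theorem transport_trans (c : Contraction 𝒢 r) (d : Contraction 𝒢 s) (h : r ≤ s) (p : RelPair r) :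
    (c.trans d h).transport (p.inclusion h) = c.transport p :=
  div_mul_mul_right _ _ (congrArg d.arrow (c.src_eq p.rel))

/-- The image of a contraction under a continuous map of groupoids over `X`. -/
def map {S : Type*} [TopologicalSpace S] {Γ : TopologicalGroupoid X S} (c : Contraction 𝒢 r)
    {φ : G → S} (hφ : Continuous φ) (hsrc : ∀ g, Γ.src (φ g) = 𝒢.src g)
    (htgt : ∀ g, Γ.tgt (φ g) = 𝒢.tgt g) : Contraction Γ r where
  arrow x := φ (c.arrow x)
  continuous_arrow := hφ.comp c.continuous_arrow
  tgt_arrow x := (htgt _).trans (c.tgt_arrow x)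
  rel_src x := by
    rw [hsrc]
    exact c.rel_src x
  src_eq h := by rw [hsrc, hsrc, c.src_eq h]

/-- Contractions of an increasing sequence of relations, modified so that the arrows of each stage
extend those of the preceding one. -/
def tower {r : ℕ → Setoid X} (mono : ∀ n, r n ≤ r (n + 1)) (d : ∀ n, Contraction 𝒢 (r n)) :
    ∀ n, Contraction 𝒢 (r n)
  | 0 => d 0
  | n + 1 => (tower mono d n).trans (d (n + 1)) (mono n)

end Contraction

end TopologicalGroupoid

open TopologicalGroupoid

/-! ### Compact étale equivalence relations -/

namespace RelPair

variable {X : Type*}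

theorem tgt_image_src_preimage (r : Setoid X) (A : Set X) :
    (tgt '' (src ⁻¹' A : Set (RelPair r))) = Quotient.mk r ⁻¹' (Quotient.mk r '' A) := by
  ext x
  constructor
  · rintro ⟨p, hp, rfl⟩
    exact ⟨p.src, hp, Quotient.sound (r.symm p.rel)⟩
  · rintro ⟨y, hy, hyx⟩
    exact ⟨⟨x, y, r.symm (Quotient.exact hyx)⟩, hy, rfl⟩

theorem exists_glue {Y : Type*} {r : ℕ → Setoid X} {s : Setoid X} (mono : ∀ n, r n ≤ r (n + 1))
    (le : ∀ n, r n ≤ s) (hex : ∀ x y, s x y → ∃ n, r n x y) {F : ∀ n, RelPair (r n) → Y}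
    (hF : ∀ n p, F (n + 1) (inclusion (mono n) p) = F n p) :
    ∃ σ : RelPair s → Y, ∀ n p, σ (inclusion (le n) p) = F n p := by
  have hF' {m n : ℕ} (hmn : m ≤ n) (p : RelPair (r m)) :
      F n (inclusion (monotone_nat_of_le_succ mono hmn) p) = F m p := by
    induction n, hmn using Nat.le_induction with
    | base => rfl
    | succ n hmn ih => exact (hF n _).trans ih
  choose N hN using fun p : RelPair s => hex p.tgt p.src p.rel
  refine ⟨fun p => F (N p) ⟨p.tgt, p.src, hN p⟩, fun n p => ?_⟩
  exact (hF' (le_max_right n _) _).symm.trans (hF' (le_max_left n _) p)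

end RelPair

namespace EtaleEquivRel

variable {X : Type*} [TopologicalSpace X] {L : EtaleEquivRel X}

theorem continuous_tgt (L : EtaleEquivRel X) : Continuous (RelPair.tgt : RelPair L.rel → X) :=
  L.groupoid.continuous_tgt

theorem continuous_src (L : EtaleEquivRel X) : Continuous (RelPair.src : RelPair L.rel → X) :=
  L.groupoid.continuous_src

theorem continuous_transport {G : Type*} [TopologicalSpace G] {𝒢 : TopologicalGroupoid X G}
    (c : Contraction 𝒢 L.rel) : Continuous c.transport :=
  continuous_div (c.continuous_arrow.comp L.continuous_tgt)
    (c.continuous_arrow.comp L.continuous_src) _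

theorem isOpen_saturation (L : EtaleEquivRel X) {A : Set X} (hA : IsOpen A) :
    IsOpen (Quotient.mk L.rel ⁻¹' (Quotient.mk L.rel '' A)) := by
  rw [← RelPair.tgt_image_src_preimage]
  exact L.isLocalHomeomorph_tgt.isOpenMap _ (hA.preimage L.continuous_src)

namespace IsCEER

variable [T2Space X]

theorem isClosed_saturation (hL : L.IsCEER) {A : Set X} (hA : IsClosed A) :
    IsClosed (Quotient.mk L.rel ⁻¹' (Quotient.mk L.rel '' A)) := by
  have hunion : RelPair.tgt '' (RelPair.src ⁻¹' A : Set (RelPair L.rel)) =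
      A ∪ RelPair.tgt '' ({p : RelPair L.rel | p.tgt ≠ p.src} ∩ RelPair.src ⁻¹' A) := by
    ext x
    constructor
    · rintro ⟨p, hp, rfl⟩
      by_cases hdiag : p.tgt = p.src
      · exact Or.inl (hdiag ▸ hp)
      · exact Or.inr ⟨p, ⟨hdiag, hp⟩, rfl⟩
    · rintro (hx | ⟨p, ⟨-, hp⟩, rfl⟩)
      · exact ⟨RelPair.diag L.rel x, hx, rfl⟩
      · exact ⟨p, hp, rfl⟩
  rw [← RelPair.tgt_image_src_preimage, hunion]
  have hcompact := hL.inter_right (hA.preimage L.continuous_src)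
  exact hA.union (hcompact.image L.continuous_tgt).isClosed

theorem exists_injOn_nhds (hL : L.IsCEER) (x : X) :
    ∃ U ∈ 𝓝 x, U.InjOn (Quotient.mk L.rel) := by
  let offDiag : Set (X × X) :=
    (fun p : RelPair L.rel => (p.tgt, p.src)) '' {p | p.tgt ≠ p.src}
  have hclosed : IsClosed offDiag :=
    (hL.image (L.continuous_tgt.prodMk L.continuous_src)).isClosed
  have hx : (x, x) ∉ offDiag := by
    rintro ⟨p, hp, h⟩
    exact hp ((congrArg Prod.fst h).trans (congrArg Prod.snd h).symm)
  obtain ⟨U, hU, V, hV, hUV⟩ := mem_nhds_prod_iff.1 (hclosed.isOpen_compl.mem_nhds hx)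
  refine ⟨U ∩ V, Filter.inter_mem hU hV, fun y hy z hz hyz => ?_⟩
  by_contra hne
  exact @hUV (y, z) ⟨hy.1, hz.2⟩ ⟨⟨y, z, Quotient.exact hyz⟩, hne, rfl⟩

/-- The base point of a class is its unique point in the first set of a countable clopen cover that
it meets, where the sets of the cover contain at most one point of each class. -/
theorem nonempty_contraction [LocallyCompactSpace X] [LindelofSpace X]
    [TotallyDisconnectedSpace X] (hL : L.IsCEER) : Nonempty (Contraction L.groupoid L.rel) := by
  choose U hU hinj using hL.exists_injOn_nhds
  obtain ⟨s, A, hs, hA, hAU, hcov⟩ := exists_countable_isClopen_cover hU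
  have := hs.to_subtype
  let B (i : s) : Set X := Quotient.mk L.rel ⁻¹' (Quotient.mk L.rel '' A i)
  have hB (i : s) : IsClopen (B i) :=
    ⟨hL.isClosed_saturation (hA i).isClosed, L.isOpen_saturation (hA i).isOpen⟩
  obtain ⟨n, hn, hmem, hninv⟩ := exists_isLocallyConstant_index hB
    fun x => (hcov x).imp fun i hi => ⟨x, hi, rfl⟩
  choose f hfA hf using hmem
  have hrel (x : X) : L.rel x (f x) := L.rel.symm (Quotient.exact (hf x))
  have huniq {x y : X} (hy : y ∈ A (n x)) (hxy : L.rel x y) : f x = y :=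
    (hinj _).mono (hAU _) (hfA x) hy ((hf x).trans (Quotient.sound hxy))
  have hfinv {x y : X} (hxy : L.rel x y) : f x = f y := by
    have hnxy : n x = n y := hninv x y fun i => by
      rw [Set.mem_preimage, Set.mem_preimage, Quotient.sound hxy]
    exact huniq (hnxy ▸ hfA y) (L.rel.trans hxy (hrel y))
  refine ⟨⟨fun x => ⟨x, f x, hrel x⟩, continuous_iff_continuousAt.2 fun x => ?_, fun _ => rfl,
    hrel, hfinv⟩⟩
  refine continuousAt_section_of_isOpenMap L.isLocalHomeomorph_tgt.isOpenMap rfl ?_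
  filter_upwards [L.continuous_tgt.continuousAt.eventually (hn.eventually_eq x),
    L.continuous_src.continuousAt.preimage_mem_nhds ((hA (n x)).isOpen.mem_nhds (hfA x))]
    with p hp hpA
  exact RelPair.ext rfl (huniq (hp ▸ hpA) p.rel)

end IsCEER

end EtaleEquivRel

/-! ### Splittings of twists -/

namespace Twist

section CircleAction

variable {X G S : Type*} [TopologicalSpace X] [TopologicalSpace G] [TopologicalSpace S]
  {𝒢 : TopologicalGroupoid X G} (E : Twist 𝒢 S)

/-- The action of the circle on the arrows of a twist. -/
def smul (z : Circle) (s : S) : S :=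
  E.groupoid.mul (E.incl (z, E.groupoid.tgt s)) s (E.src_incl _ _)

variable {E} {s t : S} {z w : Circle}

theorem src_smul : E.groupoid.src (E.smul z s) = E.groupoid.src s :=
  E.groupoid.src_mul _ _ _

theorem tgt_smul : E.groupoid.tgt (E.smul z s) = E.groupoid.tgt s :=
  (E.groupoid.tgt_mul _ _ _).trans (E.tgt_incl _ _)

theorem proj_incl (x : X) : E.proj (E.incl (z, x)) = 𝒢.unit x := by
  obtain ⟨y, hy⟩ := (E.exact (E.incl (z, x))).2 ⟨_, rfl⟩
  have hsrc := congrArg 𝒢.src hy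
  rw [E.src_proj, E.src_incl, 𝒢.src_unit] at hsrc
  rw [hy, hsrc]

theorem proj_smul : E.proj (E.smul z s) = E.proj s := by
  unfold smul
  rw [E.proj_mul, 𝒢.mul_congr (proj_incl _) rfl, unit_mul']

theorem incl_one (x : X) : E.incl (1, x) = E.groupoid.unit x := by
  have hidem := E.incl_mul 1 1 x
  rw [mul_one] at hidem
  have hunit := eq_unit_of_mul_self _ hidem.symm
  rwa [E.tgt_incl] at hunit

theorem one_smul (s : S) : E.smul 1 s = s := by
  unfold smul
  rw [E.groupoid.mul_congr (incl_one _) rfl, unit_mul']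

theorem mul_smul (z w : Circle) (s : S) : E.smul (z * w) s = E.smul z (E.smul w s) := by
  unfold smul
  rw [E.groupoid.mul_congr (E.incl_mul z w _) rfl,
    E.groupoid.mul_assoc _ _ _ _ (E.src_incl w (E.groupoid.tgt s))]
  exact E.groupoid.mul_congr (congrArg (fun x => E.incl (z, x)) tgt_smul.symm) rfl _

theorem smul_mul (e : E.groupoid.src s = E.groupoid.tgt t) :
    E.groupoid.mul (E.smul z s) t (src_smul.trans e) = E.smul z (E.groupoid.mul s t e) := by
  unfold smul
  rw [E.groupoid.mul_assoc _ s t (E.src_incl _ _) e]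
  exact E.groupoid.mul_congr (by rw [E.groupoid.tgt_mul]) rfl _

theorem smul_eq_mul_incl (z : Circle) (s : S) :
    E.smul z s = E.groupoid.mul s (E.incl (z, E.groupoid.src s)) (E.tgt_incl _ _).symm :=
  E.central z s

theorem mul_smul_comm (e : E.groupoid.src s = E.groupoid.tgt t) :
    E.groupoid.mul s (E.smul z t) (e.trans tgt_smul.symm) = E.smul z (E.groupoid.mul s t e) := by
  rw [smul_eq_mul_incl z (E.groupoid.mul s t e), E.groupoid.mul_congr rfl (smul_eq_mul_incl z t),
    ← E.groupoid.mul_assoc s t _ e (E.tgt_incl _ _).symm]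
  exact E.groupoid.mul_congr rfl (by rw [E.groupoid.src_mul]) _

theorem smul_mul_smul (e : E.groupoid.src s = E.groupoid.tgt t) :
    E.groupoid.mul (E.smul z s) (E.smul w t) (src_smul.trans (e.trans tgt_smul.symm)) =
      E.smul (z * w) (E.groupoid.mul s t e) := by
  rw [smul_mul (e.trans tgt_smul.symm), mul_smul_comm e, mul_smul]

theorem smul_unit (z : Circle) (x : X) : E.smul z (E.groupoid.unit x) = E.incl (z, x) := by
  rw [← incl_one]
  unfold smul
  rw [E.groupoid.mul_congr (h := E.incl (1, x)) (by rw [E.tgt_incl]) rfl, ← E.incl_mul, mul_one]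

theorem smul_left_injective (s : S) : Function.Injective fun z => E.smul z s := fun _ _ h =>
  congrArg Prod.fst (E.injective_incl (mul_right_cancel h))

theorem exists_smul_eq (h : E.proj s = E.proj t) : ∃ z, E.smul z s = t := by
  have hsrc : E.groupoid.src t = E.groupoid.src s := by rw [← E.src_proj, ← E.src_proj, h]
  have hunit : E.proj (E.groupoid.div t s hsrc) = 𝒢.unit (𝒢.tgt (E.proj s)) := by
    rw [← TopologicalGroupoid.div_self]
    refine eq_div_of_mul_eq (by rw [E.src_proj, E.tgt_proj, src_div]) ?_
    rw [← E.proj_mul _ _ (src_div hsrc), TopologicalGroupoid.div_mul_cancel, h]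
  obtain ⟨⟨z, x⟩, hz⟩ := (E.exact _).1 ⟨_, hunit⟩
  obtain rfl : x = E.groupoid.tgt s := by rw [← E.src_incl z x, hz, src_div]
  refine ⟨z, ?_⟩
  unfold smul
  rw [E.groupoid.mul_congr hz rfl, TopologicalGroupoid.div_mul_cancel]

theorem continuous_smul : Continuous fun p : Circle × S => E.smul p.1 p.2 :=
  continuous_mul' (E.continuous_incl.comp
    (continuous_fst.prodMk (E.groupoid.continuous_tgt.comp continuous_snd))) continuous_snd _

variable (E) in
/-- The circle action as a `MulAction`. It depends on `E`, so it is not an instance. -/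
abbrev mulAction : MulAction Circle S where
  smul := E.smul
  one_smul := one_smul
  mul_smul := mul_smul

variable (E) in
theorem hasLocalSections_proj : HasLocalSections E.proj := by
  have := E.t2Space
  have := E.locallyCompactSpace
  let _ : MulAction Circle S := E.mulAction
  have : ContinuousSMul Circle S := ⟨continuous_smul⟩
  refine hasLocalSections_of_free_circle_action E.isQuotientMap_proj (fun s t => ?_)
    smul_left_injective
  refine ⟨fun h => exists_smul_eq h.symm, ?_⟩
  rintro ⟨z, rfl⟩
  exact proj_smul

variable (E) in
theorem nonempty_contraction [T2Space X] [LocallyCompactSpace X] [LindelofSpace X]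
    [TotallyDisconnectedSpace X] {r : Setoid X} (c : Contraction 𝒢 r) :
    Nonempty (Contraction E.groupoid r) := by
  obtain ⟨d, hd, hproj⟩ := E.hasLocalSections_proj.exists_continuous_lift c.continuous_arrow
  have htgt (x : X) : E.groupoid.tgt (d x) = x := by rw [← E.tgt_proj, hproj, c.tgt_arrow]
  have hsrc (x : X) : E.groupoid.src (d x) = 𝒢.src (c.arrow x) := by rw [← E.src_proj, hproj]
  exact ⟨⟨d, hd, htgt, fun x => (hsrc x).symm ▸ c.rel_src x,
    fun h => (hsrc _).trans ((c.src_eq h).trans (hsrc _).symm)⟩⟩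

end CircleAction

/-- A splitting of the extension `E`: a continuous section of the projection that is a morphism of
groupoids. -/
structure Splitting {X G S : Type*} [TopologicalSpace X] [TopologicalSpace G]
    [TopologicalSpace S] {𝒢 : TopologicalGroupoid X G} (E : Twist 𝒢 S) where
  toFun : G → S
  continuous_toFun : Continuous toFun
  proj_toFun : ∀ g, E.proj (toFun g) = g
  map_mul : ∀ g h (e : 𝒢.src g = 𝒢.tgt h), toFun (𝒢.mul g h e) =
    E.groupoid.mul (toFun g) (toFun h)
      (by rw [← E.src_proj, ← E.tgt_proj, proj_toFun, proj_toFun, e])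

namespace Splitting

variable {X G S : Type*} [TopologicalSpace X] [TopologicalSpace G] [TopologicalSpace S]
  {𝒢 : TopologicalGroupoid X G} {E : Twist 𝒢 S} (σ : Splitting E)

/-- The circle coordinate of `s` in the trivialization defined by a splitting. -/
noncomputable def coord (s : S) : Circle :=
  (exists_smul_eq (σ.proj_toFun (E.proj s))).choose

theorem coord_smul_toFun (s : S) : E.smul (σ.coord s) (σ.toFun (E.proj s)) = s :=
  (exists_smul_eq (σ.proj_toFun (E.proj s))).choose_spec

theorem coord_eq {s : S} {g : G} {z : Circle} (h : E.smul z (σ.toFun g) = s) :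
    σ.coord s = z := by
  obtain rfl : g = E.proj s := by rw [← h, proj_smul, σ.proj_toFun]
  exact smul_left_injective _ ((σ.coord_smul_toFun s).trans h.symm)

theorem continuous_coord : Continuous σ.coord := by
  have := E.t2Space
  have hgraph : {q : S × Circle | σ.coord q.1 = q.2} =
      {q | E.smul q.2 (σ.toFun (E.proj q.1)) = q.1} := by
    ext ⟨s, z⟩
    refine ⟨?_, σ.coord_eq⟩
    rintro (rfl : σ.coord s = z)
    exact σ.coord_smul_toFun s
  refine continuous_of_isClosed_graph (hgraph ▸ isClosed_eq ?_ continuous_fst)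
  exact continuous_smul.comp (continuous_snd.prodMk
    (σ.continuous_toFun.comp (E.isQuotientMap_proj.continuous.comp continuous_fst)))

theorem coord_mul (s t : S) (e : E.groupoid.src s = E.groupoid.tgt t) :
    σ.coord (E.groupoid.mul s t e) = σ.coord s * σ.coord t := by
  refine σ.coord_eq (g := 𝒢.mul (E.proj s) (E.proj t) ?_) ?_
  · rw [E.src_proj, E.tgt_proj, e]
  · rw [σ.map_mul, ← smul_mul_smul]
    exact E.groupoid.mul_congr (σ.coord_smul_toFun s) (σ.coord_smul_toFun t) _

theorem map_unit (x : X) : σ.toFun (𝒢.unit x) = E.groupoid.unit x := by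
  have hidem := σ.map_mul (𝒢.unit x) (𝒢.unit x) ((𝒢.src_unit x).trans (𝒢.tgt_unit x).symm)
  rw [unit_mul'] at hidem
  rw [eq_unit_of_mul_self _ hidem.symm, ← E.tgt_proj, σ.proj_toFun, 𝒢.tgt_unit]

theorem coord_incl (z : Circle) (x : X) : σ.coord (E.incl (z, x)) = z :=
  σ.coord_eq (g := 𝒢.unit x) (by rw [σ.map_unit, smul_unit])

theorem isTrivial [T2Space G] [LocallyCompactSpace G] (σ : Splitting E) : E.IsTrivial := by
  let trivialization : S ≃ₜ G × Circle :=
    { toFun := fun s => (E.proj s, σ.coord s)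
      invFun := fun p => E.smul p.2 (σ.toFun p.1)
      left_inv := σ.coord_smul_toFun
      right_inv := fun _ => Prod.ext (proj_smul.trans (σ.proj_toFun _)) (σ.coord_eq rfl)
      continuous_toFun := E.isQuotientMap_proj.continuous.prodMk σ.continuous_coord
      continuous_invFun :=
        continuous_smul.comp (continuous_snd.prodMk (σ.continuous_toFun.comp continuous_fst)) }
  exact ⟨⟨trivialization, E.src_proj, E.tgt_proj,
    fun s t e => Prod.ext (E.proj_mul s t e) (σ.coord_mul s t e),
    fun _ => Prod.ext (proj_incl _) (σ.coord_incl _ _), fun _ => rfl⟩⟩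

end Splitting

theorem nonempty_splitting_of_contractions {X S : Type*} [TopologicalSpace X]
    [TopologicalSpace S] {R : EtaleEquivRel X} (E : Twist R.groupoid S) {K : ℕ → EtaleEquivRel X}
    (mono : ∀ n, (K n).rel ≤ (K (n + 1)).rel) (le : ∀ n, (K n).rel ≤ R.rel)
    (hex : ∀ x y, R.rel x y → ∃ n, (K n).rel x y)
    (htop : ∀ U : Set (RelPair R.rel), (∀ n, IsOpen (RelPair.inclusion (le n) ⁻¹' U)) → IsOpen U)
    (d : ∀ n, Contraction E.groupoid (K n).rel) : Nonempty (Splitting E) := by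
  let c := Contraction.tower mono d
  obtain ⟨σ, hσ⟩ := RelPair.exists_glue mono le hex (F := fun n => (c n).transport)
    fun n => (c n).transport_trans (d (n + 1)) (mono n)
  have hproj (p : RelPair R.rel) : E.proj (σ p) = p := by
    obtain ⟨n, hn⟩ := hex p.tgt p.src p.rel
    have hσp : σ p = (c n).transport ⟨p.tgt, p.src, hn⟩ := hσ n ⟨p.tgt, p.src, hn⟩
    refine RelPair.ext ((E.tgt_proj _).trans ?_) ((E.src_proj _).trans ?_)
    · rw [hσp, Contraction.tgt_transport]
    · rw [hσp, Contraction.src_transport]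
  refine ⟨⟨σ, continuous_def.2 fun W hW => htop _ fun n => ?_, hproj, ?_⟩⟩
  · have hcomp : σ ∘ RelPair.inclusion (le n) = (c n).transport := funext (hσ n)
    rw [← Set.preimage_comp, hcomp]
    exact hW.preimage (EtaleEquivRel.continuous_transport (c n))
  · rintro ⟨x, y, hxy⟩ ⟨y', z, hyz⟩ e
    obtain rfl : y = y' := e
    have hmono := monotone_nat_of_le_succ mono
    obtain ⟨m, hm⟩ := hex x y hxy
    obtain ⟨n, hn⟩ := hex y z hyz
    let p : RelPair (K (max m n)).rel := ⟨x, y, hmono (le_max_left m n) hm⟩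
    let q : RelPair (K (max m n)).rel := ⟨y, z, hmono (le_max_right m n) hn⟩
    calc σ _ = (c (max m n)).transport (p.mul q rfl) := hσ _ (p.mul q rfl)
      _ = _ := (c (max m n)).transport_mul p q rfl
      _ = _ := E.groupoid.mul_congr (hσ _ p).symm (hσ _ q).symm _

end Twist

theorem proposition4p6 {X : Type*} [TopologicalSpace X] [T2Space X] [LocallyCompactSpace X]
    [SecondCountableTopology X] [TotallyDisconnectedSpace X]
    (R : EtaleEquivRel X) (hR : R.IsAF)
    {S : Type*} [TopologicalSpace S] (E : Twist R.groupoid S) :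
    E.IsTrivial := by
  obtain ⟨K, mono, le, hK, -, hex, htop⟩ := hR
  have hincl (n : ℕ) : Continuous (RelPair.inclusion (le n)) :=
    continuous_def.2 fun U hU => (htop U).1 hU n
  have hcontr (n : ℕ) : Nonempty (Contraction E.groupoid (K n).rel) := by
    obtain ⟨c⟩ := (hK n).nonempty_contraction
    exact E.nonempty_contraction (c.map (hincl n) (fun _ => rfl) fun _ => rfl)
  obtain ⟨σ⟩ := E.nonempty_splitting_of_contractions mono le hex (fun U => (htop U).2)
    fun n => (hcontr n).some
  exact σ.isTrivial
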